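/- All Hilbert spaces are finite-dimensional and complex, and $\mathrm{S}(\mathcal{H})$ denotes the set of density matrices on $\mathcal{H}$. For a unit vector $|\theta\rangle\in\mathcal{H}$ and $0\le m\le n$ let $$\mathcal{V}(\mathcal{H}^{\otimes n},|\theta\rangle^{\otimes m}):=\{\pi(|\theta\rangle^{\otimes m}\otimes|\Omega\rangle):\ \pi\in\mathcal{S}_n,\ |\Omega\rangle\in\mathcal{H}^{\otimes (n-m)}\},$$ where permutations $\pi\in\mathcal{S}_n$ act on $\mathcal{H}^{\otimes n}$ by permuting the tensor factors. Let $\sigma_A\in\mathrm{S}(\mathcal{H}_A)$ and let $0\le r\le n$ be integers. A density matrix $\rho_{A_1^n}\in\mathrm{S}(\mathcal{H}_A^{\otimes n})$ is called an $\binom{n}{r}$-almost-iid state in $\sigma_A$ if there exist a purification $|\theta\rangle_{AE}\in\mathcal{H}_A\otimes\mathcal{H}_E$ of $\sigma_A$, for some $\mathcal{H}_E$, and an extension $\rho_{A_1^nE_1^n}\in\mathrm{S}\big((\mathcal{H}_A\otimes\mathcal{H}_E)^{\otimes n}\big)$ of $\rho_{A_1^n}$ (that is, $\mathrm{tr}_{E_1^n}[\rho_{A_1^nE_1^n}]=\rho_{A_1^n}$)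 such that (i) $\rho_{A_1^nE_1^n}$ is invariant under permutations of the $n$ pairs $(A_i,E_i)$; (ii) $\mathrm{supp}(\rho_{A_1^nE_1^n}):=\ker(\rho_{A_1^nE_1^n})^\perp\subseteq\mathrm{span}\,\mathcal{V}\big((\mathcal{H}_A\otimes\mathcal{H}_E)^{\otimes n},|\theta\rangle_{AE}^{\otimes (n-r)}\big)$. **Proposition.** Let $n\ge 1$ and $0\le r,s\le n$ be integers, let $\sigma_A\in\mathrm{S}(\mathcal{H}_A)$, and let $\rho_{A_1^n}$ be an $\binom{n}{r}$-almost-iid state in $\sigma_A$. Then $$\big\|\mathrm{tr}_{n-s}[\rho_{A_1^n}]-\sigma_A^{\otimes s}\big\|_1\le 4\sqrt{\frac{rs}{n}},$$ where $\|\cdot\|_1$ is the trace norm and $\mathrm{tr}_{n-s}$ is the partial trace over the last $n-s$ of the $n$ subsystems. -/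

import Mathlib

/-! Finite-dimensional quantum systems in coordinates: the Hilbert space of a system `A` is
`EuclideanSpace ℂ A` for a finite type `A`, its `n`-fold tensor power is
`EuclideanSpace ℂ (Fin n → A)`, the space of the composite system `AE` is
`EuclideanSpace ℂ (A × E)`, and operators are complex matrices. -/

noncomputable section

namespace AlmostIID

open scoped ComplexOrder

/-- Density matrices: positive semidefinite matrices of trace one. -/
def IsDensity {X : Type*} [Fintype X] (ρ : Matrix X X ℂ) : Prop :=
  ρ.PosSemidef ∧ ρ.trace = 1

/-- The trace norm, i.e. the sum of the singular values. -/
def traceNorm {X : Type*} [Fintype X] [DecidableEq X] (M : Matrix X X ℂ) : ℝ :=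
  ∑ i ∈ Finset.range (Fintype.card X), (Matrix.toEuclideanLin M).singularValues i

/-- The support `ker(M)ᗮ` of an operator `M`. -/
def supp {X : Type*} [Fintype X] [DecidableEq X] (M : Matrix X X ℂ) :
    Submodule ℂ (EuclideanSpace ℂ X) :=
  (LinearMap.ker (Matrix.toEuclideanLin M))ᗮ

/-- The `s`-fold tensor power of an operator. -/
def tensorPow {A : Type*} (σ : Matrix A A ℂ) (s : ℕ) : Matrix (Fin s → A) (Fin s → A) ℂ :=
  Matrix.of fun x y => ∏ i, σ (x i) (y i)

/-- Joins a configuration of the first `s` of `n` systems with one of the last `n - s`. -/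
def join {A : Type*} {n s : ℕ} (h : s ≤ n) (x : Fin s → A) (z : Fin (n - s) → A) : Fin n → A :=
  fun i => Fin.append x z (Fin.cast (Nat.add_sub_of_le h).symm i)

/-- The partial trace `tr_{n-s}` over the last `n - s` of `n` systems. -/
def trLast {A : Type*} [Fintype A] {n s : ℕ} (h : s ≤ n) (ρ : Matrix (Fin n → A) (Fin n → A) ℂ) :
    Matrix (Fin s → A) (Fin s → A) ℂ :=
  Matrix.of fun x y => ∑ z : Fin (n - s) → A, ρ (join h x z) (join h y z)

/-- The partial trace over `E` of an operator on `AE`. -/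
def trE {A E : Type*} [Fintype E] (M : Matrix (A × E) (A × E) ℂ) : Matrix A A ℂ :=
  Matrix.of fun a b => ∑ e, M (a, e) (b, e)

/-- The partial trace over `E₁ … Eₙ` of an operator on `A₁E₁ … AₙEₙ`. -/
def trEs {A E : Type*} [Fintype E] {n : ℕ}
    (M : Matrix (Fin n → A × E) (Fin n → A × E) ℂ) : Matrix (Fin n → A) (Fin n → A) ℂ :=
  Matrix.of fun x y => ∑ z : Fin n → E, M (fun i => (x i, z i)) (fun i => (y i, z i))

/-- `θ` is a purification of `σ`: a vector of `AE` with `tr_E |θ⟩⟨θ| = σ`. -/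
def IsPurification {A E : Type*} [Fintype E]
    (θ : EuclideanSpace ℂ (A × E)) (σ : Matrix A A ℂ) : Prop :=
  trE (Matrix.vecMulVec θ.ofLp (star θ.ofLp)) = σ

/-- The operator on an `n`-fold tensor power that permutes the tensor factors by `π`. -/
def permVec {X : Type*} {n : ℕ} (π : Equiv.Perm (Fin n)) (ψ : EuclideanSpace ℂ (Fin n → X)) :
    EuclideanSpace ℂ (Fin n → X) :=
  WithLp.toLp 2 fun x => ψ (x ∘ π)

/-- `M` is invariant under all permutations of the tensor factors: the matrix entries of
`π M π†` are those of `M` at permuted configurations. -/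
def IsPermInvariant {X : Type*} {n : ℕ} (M : Matrix (Fin n → X) (Fin n → X) ℂ) : Prop :=
  ∀ π : Equiv.Perm (Fin n), M.submatrix (fun x => x ∘ π) (fun x => x ∘ π) = M

/-- The vector `θ^{⊗ m} ⊗ Ω` of an `n`-fold tensor power, where `Ω` is a vector on the last
`n - m` factors. -/
def powTensor {X : Type*} {n m : ℕ} (h : m ≤ n) (θ : EuclideanSpace ℂ X)
    (Ω : EuclideanSpace ℂ (Fin (n - m) → X)) : EuclideanSpace ℂ (Fin n → X) :=
  WithLp.toLp 2 fun x =>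
    (∏ i : Fin m, θ (x (Fin.castLE h i))) *
      Ω (fun j => x (Fin.cast (Nat.add_sub_of_le h) (Fin.natAdd m j)))

/-- The set of vectors `π (θ^{⊗ m} ⊗ Ω)` of an `n`-fold tensor power, for all permutations `π`
and all vectors `Ω` on `n - m` factors. -/
def defectVectors {X : Type*} {n m : ℕ} (h : m ≤ n) (θ : EuclideanSpace ℂ X) :
    Set (EuclideanSpace ℂ (Fin n → X)) :=
  {ψ | ∃ (π : Equiv.Perm (Fin n)) (Ω : EuclideanSpace ℂ (Fin (n - m) → X)),
    ψ = permVec π (powTensor h θ Ω)}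

/-- `ρ` is an `(n choose r)`-almost-iid state in `σ` (for `r ≤ n`): there are a finite-dimensional
system `E`, a purification `θ` of `σ` on `AE`, and a density matrix `R` on `A₁E₁ … AₙEₙ` that
extends `ρ`, is invariant under permutations of the pairs `(Aᵢ, Eᵢ)`, and has its support in the
span of the vectors `π (θ^{⊗ (n-r)} ⊗ Ω)`. -/
def IsAlmostIID {A : Type*} [Fintype A] [DecidableEq A] {n : ℕ} (r : ℕ)
    (σ : Matrix A A ℂ) (ρ : Matrix (Fin n → A) (Fin n → A) ℂ) : Prop :=
  IsDensity ρ ∧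
  ∃ (d : ℕ) (θ : EuclideanSpace ℂ (A × Fin d))
    (R : Matrix (Fin n → A × Fin d) (Fin n → A × Fin d) ℂ),
    IsPurification θ σ ∧ IsDensity R ∧ trEs R = ρ ∧ IsPermInvariant R ∧
      supp R ≤ Submodule.span ℂ (defectVectors (Nat.sub_le n r) θ)

end AlmostIID

end

/-! Take a purification `θ` of `σ` and an extension `R` of `ρ` as in the definition of an almost-iid
state. The fidelity of the marginal of `R` on the first `s` sites with `θ^{⊗s}` is at least
`1 - r s / n`: let `Qᵢ` be the projection onto the orthogonal complement of `θ` at site `i`. A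
vector `π (θ^{⊗(n-r)} ⊗ Ω)` is killed by all but `r` of the commuting projections `Qᵢ`, so
`∑ᵢ Qᵢ ≤ r` on the span of these vectors, which supports `R`. By permutation invariance every `Qᵢ`
then has expectation at most `r / n` in `R`, and the union bound `1 - ∏ᵢ (1 - Qᵢ) ≤ ∑ᵢ Qᵢ` over the
first `s` sites bounds the infidelity by `r s / n`.

The Fuchs–van de Graaf inequality turns this into the trace norm bound `2 √(r s / n)` for the
marginal of `R`, and tracing out the purifying systems does not increase the trace norm. -/

namespace AlmostIID

open Matrix
open scoped ComplexOrder InnerProductSpace Kronecker Matrix.Norms.L2Operator MatrixOrder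

section HilbertSpace

variable {𝕜 H ι : Type*} [RCLike 𝕜] [NormedAddCommGroup H] [InnerProductSpace 𝕜 H]

theorem exists_orthonormalBasis_apply_eq_singularValues_smul [FiniteDimensional 𝕜 H] {n : ℕ}
    (hn : Module.finrank 𝕜 H = n) (T : H →ₗ[𝕜] H) :
    ∃ b u : OrthonormalBasis (Fin n) 𝕜 H, ∀ i, T (b i) = (T.singularValues i : 𝕜) • u i := by
  have hT := T.isSymmetric_adjoint_comp_self
  let b := hT.eigenvectorBasis hn
  have inner_apply (i j : Fin n) :
      ⟪T (b i), T (b j)⟫_𝕜 = if i = j then (T.singularValues j : 𝕜) ^ 2 else 0 := by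
    rw [← LinearMap.adjoint_inner_right, ← LinearMap.comp_apply,
      hT.apply_eigenvectorBasis hn j, ← T.sq_singularValues_fin hn j, inner_smul_right,
      orthonormal_iff_ite.mp b.orthonormal i j, mul_ite, mul_one, mul_zero, RCLike.ofReal_pow]
  let v (i : Fin n) : H := (T.singularValues i : 𝕜)⁻¹ • T (b i)
  have hv : Orthonormal 𝕜 ({i : Fin n | T.singularValues i ≠ 0}.domRestrict v) := by
    rw [orthonormal_iff_ite]
    rintro ⟨i, hi⟩ ⟨j, hj⟩
    have hj' : (T.singularValues j : 𝕜) ≠ 0 := RCLike.ofReal_ne_zero.mpr hj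
    simp only [Set.domRestrict_apply, v, inner_smul_left, inner_smul_right, inner_apply,
      Subtype.mk.injEq]
    split_ifs with hij
    · subst hij
      rw [map_inv₀, RCLike.conj_ofReal]
      field_simp
    · simp only [mul_zero]
  obtain ⟨u, hu⟩ := hv.exists_orthonormalBasis_extension_of_card_eq (by simpa using hn)
  refine ⟨b, u, fun i => ?_⟩
  by_cases hi : (T.singularValues i : 𝕜) = 0
  · rw [hi, zero_smul, ← inner_self_eq_zero (𝕜 := 𝕜), inner_apply, if_pos rfl, hi,
      zero_pow two_ne_zero]
  · rw [hu i (RCLike.ofReal_ne_zero.mp hi), smul_inv_smul₀ hi]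

theorem norm_inner_apply_sub_inner_apply_le (K : H →L[𝕜] H) (x y : H) :
    ‖⟪x, K x⟫_𝕜 - ⟪y, K y⟫_𝕜‖ ≤ ‖K‖ * (‖x - y‖ * ‖x + y‖) := by
  have polarization : ⟪x - y, K (x + y)⟫_𝕜 + ⟪x + y, K (x - y)⟫_𝕜 =
      2 * (⟪x, K x⟫_𝕜 - ⟪y, K y⟫_𝕜) := by
    simp only [map_add, map_sub, inner_add_left, inner_add_right, inner_sub_left, inner_sub_right]
    ring
  have bound (v w : H) : ‖⟪v, K w⟫_𝕜‖ ≤ ‖K‖ * (‖v‖ * ‖w‖) :=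
    calc ‖⟪v, K w⟫_𝕜‖ ≤ ‖v‖ * (‖K‖ * ‖w‖) :=
          (norm_inner_le_norm _ _).trans (by gcongr; exact K.le_opNorm w)
      _ = ‖K‖ * (‖v‖ * ‖w‖) := by ring
  have h := (norm_add_le _ _).trans (add_le_add (bound (x - y) (x + y)) (bound (x + y) (x - y)))
  rw [polarization, norm_mul, RCLike.norm_ofNat] at h
  linarith

theorem norm_sub_mul_norm_add_eq {x y : H} (hxy : ‖x‖ = ‖y‖) :
    ‖x - y‖ * ‖x + y‖ = 2 * √((‖x‖ ^ 2) ^ 2 - RCLike.re ⟪y, x⟫_𝕜 ^ 2) := by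
  have h : (‖x - y‖ * ‖x + y‖) ^ 2 = 2 ^ 2 * ((‖x‖ ^ 2) ^ 2 - RCLike.re ⟪y, x⟫_𝕜 ^ 2) := by
    rw [mul_pow, norm_sub_sq (𝕜 := 𝕜), norm_add_sq (𝕜 := 𝕜), inner_re_symm, hxy]
    ring
  rw [← Real.sqrt_sq (by positivity : 0 ≤ ‖x - y‖ * ‖x + y‖), h, Real.sqrt_mul (by positivity),
    Real.sqrt_sq zero_le_two]

theorem norm_inner_apply_sub_smul_inner_apply_le (K : H →L[𝕜] H) {θ : H} (hθ : ‖θ‖ = 1) (x : H) :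
    ‖⟪x, K x⟫_𝕜 - (‖x‖ : 𝕜) ^ 2 * ⟪θ, K θ⟫_𝕜‖ ≤
      ‖K‖ * (2 * (‖x‖ * √(‖x‖ ^ 2 - ‖⟪θ, x⟫_𝕜‖ ^ 2))) := by
  obtain ⟨c, hc, hcx⟩ := RCLike.exists_norm_mul_eq_self ⟪θ, x⟫_𝕜
  -- The phase `c` makes the overlap of `x` with the multiple `y` of `θ` of the same norm real.
  let y : H := ((‖x‖ : 𝕜) * c) • θ
  have hy : ‖x‖ = ‖y‖ := by simp [y, norm_smul, hc, hθ]
  have hyx : ⟪y, x⟫_𝕜 = ((‖x‖ * ‖⟪θ, x⟫_𝕜‖ : ℝ) : 𝕜) := by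
    have hcc : starRingEnd 𝕜 c * c = 1 := by simp [RCLike.conj_mul, hc]
    rw [inner_smul_left, map_mul, RCLike.conj_ofReal, RCLike.ofReal_mul, mul_assoc, ← hcx,
      ← mul_assoc (starRingEnd 𝕜 c), hcc, one_mul, hcx]
  have hyK : ⟪y, K y⟫_𝕜 = (‖x‖ : 𝕜) ^ 2 * ⟪θ, K θ⟫_𝕜 := by
    rw [map_smul, inner_smul_left, inner_smul_right, ← mul_assoc, RCLike.conj_mul, norm_mul, hc]
    simp
  calc ‖⟪x, K x⟫_𝕜 - (‖x‖ : 𝕜) ^ 2 * ⟪θ, K θ⟫_𝕜‖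
      ≤ ‖K‖ * (‖x - y‖ * ‖x + y‖) := hyK ▸ norm_inner_apply_sub_inner_apply_le K x y
    _ = ‖K‖ * (2 * (‖x‖ * √(‖x‖ ^ 2 - ‖⟪θ, x⟫_𝕜‖ ^ 2))) := by
        rw [norm_sub_mul_norm_add_eq (𝕜 := 𝕜) hy, hyx, RCLike.ofReal_re, mul_pow, sq (‖x‖ ^ 2),
          ← mul_sub, Real.sqrt_mul (sq_nonneg _), Real.sqrt_sq (norm_nonneg x)]

/-- The Fuchs–van de Graaf inequality for a pure state `θ` and an ensemble of vectors `v k` whose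
probabilities are their squared norms. -/
theorem norm_sum_inner_apply_sub_inner_apply_le [Fintype ι] (K : H →L[𝕜] H) {θ : H} (hθ : ‖θ‖ = 1)
    {v : ι → H} (hv : ∑ k, ‖v k‖ ^ 2 = 1) :
    ‖∑ k, ⟪v k, K (v k)⟫_𝕜 - ⟪θ, K θ⟫_𝕜‖ ≤
      ‖K‖ * (2 * √(1 - ∑ k, ‖⟪θ, v k⟫_𝕜‖ ^ 2)) := by
  have overlap_le (k : ι) : 0 ≤ ‖v k‖ ^ 2 - ‖⟪θ, v k⟫_𝕜‖ ^ 2 := by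
    have h := norm_inner_le_norm (𝕜 := 𝕜) θ (v k)
    rw [hθ, one_mul] at h
    exact sub_nonneg.mpr (pow_le_pow_left₀ (norm_nonneg _) h 2)
  have cauchy_schwarz : ∑ k, ‖v k‖ * √(‖v k‖ ^ 2 - ‖⟪θ, v k⟫_𝕜‖ ^ 2) ≤
      √(1 - ∑ k, ‖⟪θ, v k⟫_𝕜‖ ^ 2) := by
    have h := Real.sum_mul_le_sqrt_mul_sqrt Finset.univ (fun k => ‖v k‖)
      fun k => √(‖v k‖ ^ 2 - ‖⟪θ, v k⟫_𝕜‖ ^ 2)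
    simpa only [Real.sq_sqrt (overlap_le _), Finset.sum_sub_distrib, hv, Real.sqrt_one, one_mul]
      using h
  have hsum : ∑ k, ⟪v k, K (v k)⟫_𝕜 - ⟪θ, K θ⟫_𝕜 =
      ∑ k, (⟪v k, K (v k)⟫_𝕜 - (‖v k‖ : 𝕜) ^ 2 * ⟪θ, K θ⟫_𝕜) := by
    rw [Finset.sum_sub_distrib, ← Finset.sum_mul]
    have : ∑ k, (‖v k‖ : 𝕜) ^ 2 = 1 := by exact_mod_cast congrArg ((↑) : ℝ → 𝕜) hv
    rw [this, one_mul]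
  calc ‖∑ k, ⟪v k, K (v k)⟫_𝕜 - ⟪θ, K θ⟫_𝕜‖
      ≤ ∑ k, ‖K‖ * (2 * (‖v k‖ * √(‖v k‖ ^ 2 - ‖⟪θ, v k⟫_𝕜‖ ^ 2))) := by
        rw [hsum]
        exact norm_sum_le_of_le _ fun k _ => norm_inner_apply_sub_smul_inner_apply_le K hθ (v k)
    _ ≤ ‖K‖ * (2 * √(1 - ∑ k, ‖⟪θ, v k⟫_𝕜‖ ^ 2)) := by
        simp only [← Finset.mul_sum]
        gcongr

end HilbertSpace

section TraceNorm

variable {X ι : Type*} [Fintype X] [DecidableEq X]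

theorem trace_eq_sum_inner [Fintype ι] (b : OrthonormalBasis ι ℂ (EuclideanSpace ℂ X))
    (M : Matrix X X ℂ) : M.trace = ∑ i, ⟪b i, toEuclideanCLM (𝕜 := ℂ) M (b i)⟫_ℂ := by
  classical
  simp only [← ContinuousLinearMap.coe_coe, coe_toEuclideanCLM_eq_toEuclideanLin]
  rw [← LinearMap.trace_eq_sum_inner, toEuclideanLin_eq_toLin_orthonormal, trace_toLin_eq]

theorem exists_norm_le_one_trace_mul_eq_traceNorm (M : Matrix X X ℂ) :
    ∃ S : Matrix X X ℂ, ‖S‖ ≤ 1 ∧ (S * M).trace = (traceNorm M : ℂ) := by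
  obtain ⟨b, u, hbu⟩ := exists_orthonormalBasis_apply_eq_singularValues_smul
    (finrank_euclideanSpace (𝕜 := ℂ) (ι := X)) (toEuclideanLin M)
  let U := u.equiv b (Equiv.refl _)
  refine ⟨(toEuclideanCLM (n := X) (𝕜 := ℂ)).symm U.toContinuousLinearEquiv, ?_, ?_⟩
  · rw [cstar_norm_def, StarAlgEquiv.apply_symm_apply]
    exact U.toLinearIsometry.norm_toContinuousLinearMap_le
  · have hM (i) : toEuclideanCLM (𝕜 := ℂ) M (b i) =
        ((toEuclideanLin M).singularValues i : ℂ) • u i := hbu i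
    rw [trace_eq_sum_inner b, traceNorm, Finset.sum_range]
    simp [hM, U]

theorem norm_trace_mul_le (K M : Matrix X X ℂ) : ‖(K * M).trace‖ ≤ ‖K‖ * traceNorm M := by
  obtain ⟨b, u, hbu⟩ := exists_orthonormalBasis_apply_eq_singularValues_smul
    (finrank_euclideanSpace (𝕜 := ℂ) (ι := X)) (toEuclideanLin M)
  have hM (i) : toEuclideanCLM (𝕜 := ℂ) M (b i) =
      ((toEuclideanLin M).singularValues i : ℂ) • u i := hbu i
  rw [trace_eq_sum_inner b, traceNorm, Finset.sum_range, Finset.mul_sum]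
  refine norm_sum_le_of_le _ fun i _ => ?_
  rw [map_mul, mul_apply_eq_comp, hM, map_smul, inner_smul_right, norm_mul,
    Complex.norm_real, Real.norm_of_nonneg (LinearMap.singularValues_nonneg _ _), mul_comm ‖K‖]
  gcongr
  · exact LinearMap.singularValues_nonneg _ _
  calc ‖⟪b i, toEuclideanCLM (𝕜 := ℂ) K (u i)⟫_ℂ‖
      ≤ ‖b i‖ * (‖toEuclideanCLM (𝕜 := ℂ) K‖ * ‖u i‖) :=
        (norm_inner_le_norm _ _).trans (by gcongr; exact ContinuousLinearMap.le_opNorm _ _)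
    _ = ‖K‖ := by rw [b.norm_eq_one, u.norm_eq_one, cstar_norm_def, one_mul, mul_one]

end TraceNorm

section PureState

variable {X ι : Type*}

/-- The operator `|ψ⟩⟨ψ|`. -/
def ketBra (ψ : EuclideanSpace ℂ X) : Matrix X X ℂ :=
  vecMulVec ψ.ofLp (star ψ.ofLp)

theorem conjTranspose_ketBra (ψ : EuclideanSpace ℂ X) : (ketBra ψ)ᴴ = ketBra ψ := by
  rw [ketBra, conjTranspose_vecMulVec, star_star]

variable [Fintype X]

theorem isStarProjection_ketBra {θ : EuclideanSpace ℂ X} (hθ : ‖θ‖ = 1) :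
    IsStarProjection (ketBra θ) where
  isIdempotentElem := by
    have h : star θ.ofLp ⬝ᵥ θ.ofLp = 1 := by
      rw [dotProduct_comm, ← EuclideanSpace.inner_eq_star_dotProduct,
        inner_self_eq_norm_sq_to_K, hθ, RCLike.ofReal_one, one_pow]
    rw [IsIdempotentElem, ketBra, vecMulVec_mul_vecMulVec, h, one_smul]
  isSelfAdjoint := conjTranspose_ketBra θ

theorem trace_mul_ketBra [DecidableEq X] (K : Matrix X X ℂ) (ψ : EuclideanSpace ℂ X) :
    (K * ketBra ψ).trace = ⟪ψ, toEuclideanCLM (𝕜 := ℂ) K ψ⟫_ℂ := by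
  rw [ketBra, mul_vecMulVec, trace_vecMulVec, EuclideanSpace.inner_eq_star_dotProduct]
  rfl

theorem toEuclideanCLM_ketBra_apply [DecidableEq X] (θ ψ : EuclideanSpace ℂ X) :
    toEuclideanCLM (𝕜 := ℂ) (ketBra θ) ψ = ⟪θ, ψ⟫_ℂ • θ := by
  ext x
  change (ketBra θ *ᵥ ψ.ofLp) x = _
  rw [ketBra, vecMulVec_mulVec, EuclideanSpace.inner_eq_star_dotProduct, dotProduct_comm]
  simp [mul_comm]

theorem trace_ketBra (ψ : EuclideanSpace ℂ X) : (ketBra ψ).trace = (‖ψ‖ ^ 2 : ℂ) := by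
  classical
  rw [← one_mul (ketBra ψ), trace_mul_ketBra, map_one, one_apply_eq_self,
    inner_self_eq_norm_sq_to_K]
  rfl

theorem trace_ketBra_mul_ketBra (θ ψ : EuclideanSpace ℂ X) :
    (ketBra θ * ketBra ψ).trace = (‖⟪θ, ψ⟫_ℂ‖ ^ 2 : ℂ) := by
  classical
  rw [trace_mul_ketBra, toEuclideanCLM_ketBra_apply, inner_smul_right, ← inner_conj_symm ψ θ,
    RCLike.mul_conj]
  rfl

variable [DecidableEq X]

theorem mem_supp_sum_ketBra [Fintype ι] (v : ι → EuclideanSpace ℂ X) (k : ι) :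
    v k ∈ supp (∑ k, ketBra (v k)) := by
  rw [supp, Submodule.mem_orthogonal]
  intro w hw
  have hw' : toEuclideanCLM (𝕜 := ℂ) (∑ k, ketBra (v k)) w = 0 := hw
  have sum_eq_zero : ∑ k, ‖⟪v k, w⟫_ℂ‖ ^ 2 = 0 := by
    have h : ((∑ k, ‖⟪v k, w⟫_ℂ‖ ^ 2 : ℝ) : ℂ) = 0 := by
      have h := congrArg (inner ℂ w) hw'
      simp only [map_sum, _root_.sum_apply, inner_sum, toEuclideanCLM_ketBra_apply,
        inner_smul_right, inner_zero_right] at h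
      rw [← h, Complex.ofReal_sum]
      refine Finset.sum_congr rfl fun k _ => ?_
      rw [← inner_conj_symm w (v k), RCLike.mul_conj, Complex.ofReal_pow]
      rfl
    exact_mod_cast h
  have h := (Finset.sum_eq_zero_iff_of_nonneg fun k _ => by positivity).mp sum_eq_zero k
    (Finset.mem_univ k)
  rw [← inner_conj_symm, norm_eq_zero.mp (pow_eq_zero_iff two_ne_zero |>.mp h), map_zero]

theorem IsDensity.exists_ensemble {ρ : Matrix X X ℂ} (hρ : IsDensity ρ) :
    ∃ (m : ℕ) (v : Fin m → EuclideanSpace ℂ X),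
      ρ = ∑ k, ketBra (v k) ∧ ∑ k, ‖v k‖ ^ 2 = 1 ∧ ∀ k, v k ∈ supp ρ := by
  obtain ⟨m, w, hw⟩ := posSemidef_iff_eq_sum_vecMulVec.mp hρ.1
  let v (k : Fin m) : EuclideanSpace ℂ X := WithLp.toLp 2 (w k)
  have hv : ρ = ∑ k, ketBra (v k) := hw
  refine ⟨m, v, hv, ?_, hv ▸ mem_supp_sum_ketBra v⟩
  have h := hρ.2
  simp only [hv, trace_sum, trace_ketBra] at h
  exact_mod_cast h

theorem traceNorm_sub_ketBra_le {ρ : Matrix X X ℂ} (hρ : IsDensity ρ) {θ : EuclideanSpace ℂ X}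
    (hθ : ‖θ‖ = 1) :
    traceNorm (ρ - ketBra θ) ≤ 2 * √(1 - (ketBra θ * ρ).trace.re) := by
  obtain ⟨m, v, rfl, hv, -⟩ := hρ.exists_ensemble
  obtain ⟨S, hS, hSM⟩ := exists_norm_le_one_trace_mul_eq_traceNorm (∑ k, ketBra (v k) - ketBra θ)
  have fidelity : (ketBra θ * ∑ k, ketBra (v k)).trace.re = ∑ k, ‖⟪θ, v k⟫_ℂ‖ ^ 2 := by
    simp only [Finset.mul_sum, trace_sum, trace_ketBra_mul_ketBra]
    norm_cast
  calc traceNorm (∑ k, ketBra (v k) - ketBra θ)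
      ≤ ‖(S * (∑ k, ketBra (v k) - ketBra θ)).trace‖ := by
        rw [hSM, Complex.norm_real]
        exact le_abs_self _
    _ = ‖∑ k, ⟪v k, toEuclideanCLM (𝕜 := ℂ) S (v k)⟫_ℂ -
          ⟪θ, toEuclideanCLM (𝕜 := ℂ) S θ⟫_ℂ‖ := by
        simp only [mul_sub, trace_sub, Finset.mul_sum, trace_sum, trace_mul_ketBra]
    _ ≤ ‖S‖ * (2 * √(1 - ∑ k, ‖⟪θ, v k⟫_ℂ‖ ^ 2)) :=
        norm_sum_inner_apply_sub_inner_apply_le _ hθ hv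
    _ ≤ 2 * √(1 - (ketBra θ * ∑ k, ketBra (v k)).trace.re) := by
        rw [fidelity]
        exact mul_le_of_le_one_left (by positivity) hS

end PureState

section PartialTrace

variable {A E Y : Type*} [Fintype E]

theorem trEs_sub {n : ℕ} (M N : Matrix (Fin n → A × E) (Fin n → A × E) ℂ) :
    trEs (M - N) = trEs M - trEs N := by
  ext x y
  exact Finset.sum_sub_distrib _ _

variable [Fintype A] [Fintype Y]

/-- The homomorphism `S ↦ S ⊗ 1` from the operators on `A` to those on a system with configurations
`Y`, which is split into `A` and `E` by `e`. -/
def ampliation [DecidableEq E] (e : Y ≃ A × E) : Matrix A A ℂ →⋆ₙₐ[ℂ] Matrix Y Y ℂ where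
  toFun S := (S ⊗ₖ (1 : Matrix E E ℂ)).submatrix e e
  map_smul' c S := by rw [smul_kronecker, submatrix_smul]; rfl
  map_zero' := by rw [zero_kronecker, submatrix_zero]; rfl
  map_add' S T := by rw [add_kronecker, submatrix_add]; rfl
  map_mul' S T := by rw [submatrix_mul_equiv, ← mul_kronecker_mul, one_mul]
  map_star' S := by
    rw [star_eq_conjTranspose, star_eq_conjTranspose, conjTranspose_submatrix,
      conjTranspose_kronecker, conjTranspose_one]

theorem trace_ampliation_mul [DecidableEq E] (e : Y ≃ A × E) (S : Matrix A A ℂ) (M : Matrix Y Y ℂ) :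
    (ampliation e S * M).trace = (S * trE (M.submatrix e.symm e.symm)).trace := by
  simp only [trace, diag, mul_apply, ← e.symm.sum_comp, Fintype.sum_prod_type]
  simp only [ampliation, trE, NonUnitalStarAlgHom.coe_mk', NonUnitalAlgHom.coe_mk, submatrix_apply,
    Equiv.apply_symm_apply, kroneckerMap_apply, one_apply, mul_ite, mul_one, mul_zero, ite_mul,
    zero_mul, Finset.sum_ite_eq, Finset.mem_univ, if_true, of_apply, Finset.mul_sum]
  exact Finset.sum_congr rfl fun a _ => Finset.sum_comm

variable [DecidableEq A]

theorem traceNorm_trE_submatrix_le [DecidableEq Y] (e : Y ≃ A × E) (M : Matrix Y Y ℂ) :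
    traceNorm (trE (M.submatrix e.symm e.symm)) ≤ traceNorm M := by
  classical
  obtain ⟨S, hS, hSM⟩ :=
    exists_norm_le_one_trace_mul_eq_traceNorm (trE (M.submatrix e.symm e.symm))
  have hM : 0 ≤ traceNorm M := Finset.sum_nonneg fun i _ => LinearMap.singularValues_nonneg _ i
  calc traceNorm (trE (M.submatrix e.symm e.symm))
      ≤ ‖(S * trE (M.submatrix e.symm e.symm)).trace‖ := by
        rw [hSM, Complex.norm_real]
        exact le_abs_self _
    _ = ‖(ampliation e S * M).trace‖ := by rw [trace_ampliation_mul]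
    _ ≤ ‖ampliation e S‖ * traceNorm M := norm_trace_mul_le _ _
    _ ≤ traceNorm M :=
        mul_le_of_le_one_left hM ((NonUnitalStarAlgHom.norm_apply_le _ S).trans hS)

theorem traceNorm_trEs_le [DecidableEq E] {n : ℕ} (M : Matrix (Fin n → A × E) (Fin n → A × E) ℂ) :
    traceNorm (trEs M) ≤ traceNorm M :=
  traceNorm_trE_submatrix_le (Equiv.arrowProdEquivProdArrow (Fin n) (fun _ => A) fun _ => E) M

end PartialTrace

section TensorPower

variable {A E X : Type*} {n s : ℕ}

theorem tensorPow_trE [Fintype E] (M : Matrix (A × E) (A × E) ℂ) (s : ℕ) :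
    tensorPow (trE M) s = trEs (tensorPow M s) := by
  ext x y
  exact Fintype.prod_sum fun i e => M (x i, e) (y i, e)

/-- The `s`-fold tensor power of a vector. -/
def vecPow (θ : EuclideanSpace ℂ X) (s : ℕ) : EuclideanSpace ℂ (Fin s → X) :=
  WithLp.toLp 2 fun x => ∏ i, θ (x i)

theorem tensorPow_ketBra (θ : EuclideanSpace ℂ X) (s : ℕ) :
    tensorPow (ketBra θ) s = ketBra (vecPow θ s) := by
  ext x y
  simp only [tensorPow, ketBra, vecPow, of_apply, vecMulVec_apply, Pi.star_apply, star_prod,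
    Finset.prod_mul_distrib]

theorem trace_tensorPow [Fintype X] (M : Matrix X X ℂ) (s : ℕ) :
    (tensorPow M s).trace = M.trace ^ s := by
  simpa [trace, tensorPow] using (Fintype.prod_sum fun (_ : Fin s) a => M a a).symm

theorem norm_vecPow [Fintype X] (θ : EuclideanSpace ℂ X) (s : ℕ) : ‖vecPow θ s‖ = ‖θ‖ ^ s := by
  have h : ((‖vecPow θ s‖ ^ 2 : ℝ) : ℂ) = ((‖θ‖ ^ s) ^ 2 : ℝ) := by
    push_cast
    rw [← trace_ketBra, ← tensorPow_ketBra, trace_tensorPow, trace_ketBra, pow_right_comm]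
  exact (pow_left_inj₀ (norm_nonneg _) (by positivity) two_ne_zero).mp (by exact_mod_cast h)

theorem IsPurification.norm_eq_one [Fintype A] [Fintype E] {θ : EuclideanSpace ℂ (A × E)}
    {σ : Matrix A A ℂ} (hθ : IsPurification θ σ) (hσ : IsDensity σ) : ‖θ‖ = 1 := by
  have trace_trE : (trE (ketBra θ)).trace = (ketBra θ).trace :=
    (Fintype.sum_prod_type fun x => ketBra θ x x).symm
  have h : (‖θ‖ ^ 2 : ℂ) = 1 := by rw [← trace_ketBra, ← trace_trE, ← hσ.2, ← hθ, ketBra]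
  exact (pow_eq_one_iff_of_nonneg (norm_nonneg θ) two_ne_zero).mp (by exact_mod_cast h)

end TensorPower

section Join

variable {A E : Type*} {n s : ℕ} (h : s ≤ n)

@[simp]
theorem join_castLE (x : Fin s → A) (z : Fin (n - s) → A) (i : Fin s) :
    join h x z (Fin.castLE h i) = x i :=
  Fin.append_left x z i

@[simp]
theorem join_natAdd (x : Fin s → A) (z : Fin (n - s) → A) (j : Fin (n - s)) :
    join h x z (Fin.cast (Nat.add_sub_of_le h) (Fin.natAdd s j)) = z j :=
  Fin.append_right x z j

theorem join_prodMk (x : Fin s → A) (u : Fin s → E) (z : Fin (n - s) → A)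
    (w : Fin (n - s) → E) : (fun i => (join h x z i, join h u w i)) =
      join h (fun i => (x i, u i)) fun j => (z j, w j) := by
  ext1 i
  simp only [join]
  refine Fin.addCases (fun i => ?_) (fun j => ?_) (Fin.cast (Nat.add_sub_of_le h).symm i) <;> simp

theorem prod_eq_prod_castLE_mul_prod_natAdd {M : Type*} [CommMonoid M] (f : Fin n → M) :
    ∏ i, f i = (∏ i, f (Fin.castLE h i)) *
      ∏ j, f (Fin.cast (Nat.add_sub_of_le h) (Fin.natAdd s j)) := by
  rw [← Equiv.prod_comp (finCongr (Nat.add_sub_of_le h)), Fin.prod_univ_add]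
  rfl

theorem sum_eq_sum_join [Fintype A] {M : Type*} [AddCommMonoid M] (f : (Fin n → A) → M) :
    ∑ x, f x = ∑ x, ∑ z, f (join h x z) := by
  rw [← Fintype.sum_prod_type', ← ((Fin.appendEquiv s (n - s)).trans
    ((finCongr (Nat.add_sub_of_le h)).arrowCongr (Equiv.refl A))).sum_comp]
  rfl

theorem trLast_trEs [Fintype A] [Fintype E] (R : Matrix (Fin n → A × E) (Fin n → A × E) ℂ) :
    trLast h (trEs R) = trEs (trLast h R) := by
  have sum_pair (f : (Fin (n - s) → A × E) → ℂ) :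
      ∑ z, f z = ∑ z : Fin (n - s) → A, ∑ w : Fin (n - s) → E, f fun j => (z j, w j) := by
    rw [← Fintype.sum_prod_type',
      ← (Equiv.arrowProdEquivProdArrow (Fin (n - s)) (fun _ => A) fun _ => E).symm.sum_comp]
    rfl
  ext x y
  simp only [trLast, trEs, of_apply, sum_eq_sum_join h, join_prodMk, sum_pair]
  exact Finset.sum_comm

theorem IsDensity.trLast [Fintype A] {R : Matrix (Fin n → A) (Fin n → A) ℂ} (hR : IsDensity R) :
    IsDensity (trLast h R) := by
  constructor
  · have : AlmostIID.trLast h R =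
        ∑ z, R.submatrix (fun x => join h x z) fun x => join h x z := by
      ext x y
      simp only [AlmostIID.trLast, of_apply, Matrix.sum_apply, submatrix_apply]
    exact this ▸ posSemidef_sum _ fun z _ => hR.1.submatrix _
  · rw [← hR.2]
    exact (sum_eq_sum_join h fun x => R x x).symm

end Join

section Defects

variable {𝕜 H ι : Type*} [RCLike 𝕜] [NormedAddCommGroup H] [InnerProductSpace 𝕜 H]

theorem norm_sub_apply_sq_add_norm_apply_sq {P : H →ₗ[𝕜] H} (hP : P.IsSymmetricProjection)
    (φ : H) : ‖φ - P φ‖ ^ 2 + ‖P φ‖ ^ 2 = ‖φ‖ ^ 2 := by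
  have orthogonal : ⟪φ - P φ, P φ⟫_𝕜 = 0 := by
    have hPP : P (P φ) = P φ := LinearMap.congr_fun hP.isIdempotentElem φ
    rw [← hP.isSymmetric, map_sub, hPP, sub_self, inner_zero_left]
  have h := norm_add_sq_eq_norm_sq_add_norm_sq_of_inner_eq_zero _ _ orthogonal
  rw [sub_add_cancel] at h
  linarith

/-- The span of the vectors with at most `r` defects in `J`: those annihilated by `Q i` for all but
at most `r` of the `i ∈ J`. -/
def defectSpan (Q : ι → H →ₗ[𝕜] H) (J : Finset ι) (r : ℕ) : Submodule 𝕜 H :=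
  Submodule.span 𝕜 {v | ∃ T ⊆ J, J.card ≤ T.card + r ∧ ∀ i ∈ T, Q i v = 0}

variable {Q : ι → H →ₗ[𝕜] H}

theorem apply_eq_zero_of_mem_defectSpan_zero {J : Finset ι} {a : ι} (ha : a ∈ J) {ψ : H}
    (hψ : ψ ∈ defectSpan Q J 0) : Q a ψ = 0 := by
  suffices h : defectSpan Q J 0 ≤ LinearMap.ker (Q a) from h hψ
  refine Submodule.span_le.mpr ?_
  rintro v ⟨T, hT, hc, hv⟩
  rw [← Finset.eq_of_subset_of_card_le hT hc] at ha
  exact hv a ha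

variable [DecidableEq ι] (hcomm : ∀ i j, Commute (Q i) (Q j)) {J : Finset ι} {a : ι} {r : ℕ} {ψ : H}

include hcomm

theorem sub_apply_mem_defectSpan (ha : a ∉ J) (hψ : ψ ∈ defectSpan Q (insert a J) r) :
    ψ - Q a ψ ∈ defectSpan Q J r := by
  suffices h : defectSpan Q (insert a J) r ≤
      (defectSpan Q J r).comap (LinearMap.id - Q a) from h hψ
  refine Submodule.span_le.mpr ?_
  rintro v ⟨T, hT, hc, hv⟩
  refine Submodule.subset_span ⟨T.erase a, ?_, ?_, fun i hi => ?_⟩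
  · rwa [← Finset.subset_insert_iff]
  · have := Finset.card_insert_of_notMem ha
    have := Finset.pred_card_le_card_erase (s := T) (a := a)
    lia
  · have hcomm' : Q i (Q a v) = Q a (Q i v) := LinearMap.congr_fun (hcomm i a) v
    simp [hv i (Finset.mem_of_mem_erase hi), hcomm']

theorem apply_mem_defectSpan (ha : a ∉ J) (hψ : ψ ∈ defectSpan Q (insert a J) (r + 1)) :
    Q a ψ ∈ defectSpan Q J r := by
  suffices h : defectSpan Q (insert a J) (r + 1) ≤
      (defectSpan Q J r).comap (Q a) from h hψ
  refine Submodule.span_le.mpr ?_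
  rintro v ⟨T, hT, hc, hv⟩
  by_cases haT : a ∈ T
  · simp [hv a haT]
  refine Submodule.subset_span ⟨T, ?_, ?_, fun i hi => ?_⟩
  · rwa [Finset.subset_insert_iff_of_notMem haT] at hT
  · rw [Finset.card_insert_of_notMem ha] at hc
    lia
  · have hcomm' : Q i (Q a v) = Q a (Q i v) := LinearMap.congr_fun (hcomm i a) v
    simp [hv i hi, hcomm']

omit [DecidableEq ι] in
theorem sum_norm_sq_apply_le_of_mem_defectSpan (hQ : ∀ i, (Q i).IsSymmetricProjection)
    (hψ : ψ ∈ defectSpan Q J r) : ∑ i ∈ J, ‖Q i ψ‖ ^ 2 ≤ r * ‖ψ‖ ^ 2 := by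
  classical
  induction J using Finset.induction_on generalizing r ψ with
  | empty => simpa using by positivity
  | insert a J ha ih =>
    -- In the range of `Q a` one defect is spent on `a`, which leaves at most `r - 1` for `J`.
    have split (i : ι) : ‖Q i ψ‖ ^ 2 = ‖Q i (ψ - Q a ψ)‖ ^ 2 + ‖Q i (Q a ψ)‖ ^ 2 := by
      have hcomm' : Q i (Q a ψ) = Q a (Q i ψ) := LinearMap.congr_fun (hcomm i a) ψ
      rw [map_sub, hcomm', ← norm_sub_apply_sq_add_norm_apply_sq (hQ a)]
    have complement_le := ih (sub_apply_mem_defectSpan hcomm ha hψ)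
    rw [Finset.sum_insert ha, Finset.sum_congr rfl fun i _ => split i, Finset.sum_add_distrib,
      ← norm_sub_apply_sq_add_norm_apply_sq (hQ a) ψ]
    cases r with
    | zero =>
      have hψ₀ := apply_eq_zero_of_mem_defectSpan_zero (Finset.mem_insert_self a J) hψ
      simpa [hψ₀] using complement_le
    | succ r =>
      have range_le := ih (apply_mem_defectSpan hcomm ha hψ)
      push_cast at complement_le ⊢
      linarith

end Defects

section Projections

theorem one_sub_mul_le {R : Type*} [Ring R] [StarRing R] [PartialOrder R] [StarOrderedRing R]
    {p q : R} (hp : IsStarProjection p) (hq : IsStarProjection q) (hpq : Commute p q) :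
    1 - p * q ≤ (1 - p) + (1 - q) := by
  have hcomm : Commute (1 - p) (1 - q) :=
    (Commute.one_left _).sub_left ((Commute.one_right p).sub_right hpq)
  have h := (hp.one_sub.mul hq.one_sub hcomm).nonneg
  rw [← sub_nonneg]
  convert h using 1
  noncomm_ring

theorem re_trace_mul_le_re_trace_mul {X : Type*} [Fintype X] {K L R : Matrix X X ℂ} (hKL : K ≤ L)
    (hR : R.PosSemidef) : (K * R).trace.re ≤ (L * R).trace.re := by
  classical
  obtain ⟨C, rfl⟩ := CStarAlgebra.nonneg_iff_eq_star_mul_self.mp hR.nonneg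
  have h := ((Matrix.le_iff.mp hKL).mul_mul_conjTranspose_same C).trace_nonneg
  rw [mul_assoc, trace_mul_comm, mul_assoc, sub_mul, trace_sub] at h
  exact sub_nonneg.mp (Complex.le_def.mp h).1

theorem isSymmetricProjection_toEuclideanLin {X : Type*} [Fintype X] [DecidableEq X]
    {P : Matrix X X ℂ} (hP : IsStarProjection P) : (toEuclideanLin P).IsSymmetricProjection where
  isSymmetric := isSymmetric_toEuclideanLin_iff.mpr hP.isSelfAdjoint
  isIdempotentElem := by
    rw [IsIdempotentElem, Module.End.mul_eq_comp, ← toLpLin_mul_same, hP.isIdempotentElem]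

theorem re_trace_mul_ketBra {X : Type*} [Fintype X] [DecidableEq X] {P : Matrix X X ℂ}
    (hP : IsStarProjection P) (ψ : EuclideanSpace ℂ X) :
    (P * ketBra ψ).trace.re = ‖toEuclideanLin P ψ‖ ^ 2 := by
  have h := isSymmetricProjection_toEuclideanLin hP
  have hPP : toEuclideanLin P (toEuclideanLin P ψ) = toEuclideanLin P ψ :=
    LinearMap.congr_fun h.isIdempotentElem ψ
  calc (P * ketBra ψ).trace.re = (⟪ψ, toEuclideanLin P ψ⟫_ℂ).re := by rw [trace_mul_ketBra]; rfl
    _ = (⟪toEuclideanLin P ψ, toEuclideanLin P ψ⟫_ℂ).re := by rw [h.isSymmetric, hPP]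
    _ = ‖toEuclideanLin P ψ‖ ^ 2 := inner_self_eq_norm_sq (𝕜 := ℂ) _

end Projections

section SiteOperators

variable {ι X : Type*} [Fintype ι]

/-- The tensor product `⨂ i, M i` of a family of operators. -/
def piTensor (M : ι → Matrix X X ℂ) : Matrix (ι → X) (ι → X) ℂ :=
  of fun x y => ∏ i, M i (x i) (y i)

theorem conjTranspose_piTensor (M : ι → Matrix X X ℂ) :
    (piTensor M)ᴴ = piTensor fun i => (M i)ᴴ := by
  ext x y
  simp only [piTensor, conjTranspose_apply, of_apply, star_prod]

theorem piTensor_submatrix_comp (M : ι → Matrix X X ℂ) (π : Equiv.Perm ι) :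
    (piTensor M).submatrix (· ∘ π) (· ∘ π) = piTensor (M ∘ π.symm) := by
  ext x y
  simp only [piTensor, submatrix_apply, of_apply, Function.comp_apply]
  rw [← Equiv.prod_comp π fun j => M (π.symm j) (x j) (y j)]
  simp only [Equiv.symm_apply_apply]

theorem piTensor_one [DecidableEq X] : piTensor (fun _ : ι => (1 : Matrix X X ℂ)) = 1 := by
  ext x y
  simp [piTensor, one_apply, Finset.prod_ite_zero, funext_iff]

variable [DecidableEq ι]

theorem piTensor_mul [Fintype X] (M N : ι → Matrix X X ℂ) :
    piTensor M * piTensor N = piTensor fun i => M i * N i := by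
  ext x y
  simp only [piTensor, mul_apply, of_apply, ← Finset.prod_mul_distrib]
  exact (Fintype.prod_sum fun i a => M i (x i) a * N i a (y i)).symm

theorem isStarProjection_piTensor [Fintype X] {M : ι → Matrix X X ℂ}
    (hM : ∀ i, IsStarProjection (M i)) : IsStarProjection (piTensor M) where
  isIdempotentElem := by
    rw [IsIdempotentElem, piTensor_mul]
    exact congrArg piTensor (funext fun i => (hM i).isIdempotentElem)
  isSelfAdjoint := by
    rw [isSelfAdjoint_iff, star_eq_conjTranspose, conjTranspose_piTensor]
    exact congrArg piTensor (funext fun i => (hM i).isSelfAdjoint)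

variable [DecidableEq X]

/-- The operator acting as `M` on the sites in `J` and trivially elsewhere. -/
def onSites (J : Finset ι) (M : Matrix X X ℂ) : Matrix (ι → X) (ι → X) ℂ :=
  piTensor fun i => if i ∈ J then M else 1

theorem onSites_empty (M : Matrix X X ℂ) : onSites (∅ : Finset ι) M = 1 := by
  simp only [onSites, Finset.notMem_empty, if_false, piTensor_one]

theorem onSites_submatrix_comp (J : Finset ι) (M : Matrix X X ℂ) (π : Equiv.Perm ι) :
    (onSites J M).submatrix (· ∘ π) (· ∘ π) = onSites (J.map π.toEmbedding) M := by
  rw [onSites, piTensor_submatrix_comp, onSites]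
  congr 1
  ext1 i
  simp only [Function.comp_apply, Finset.mem_map_equiv]

variable [Fintype X]

theorem onSites_insert {J : Finset ι} {a : ι} (ha : a ∉ J) (M : Matrix X X ℂ) :
    onSites (insert a J) M = onSites J M * onSites {a} M := by
  rw [onSites, onSites, onSites, piTensor_mul]
  congr 1
  ext1 i
  rcases eq_or_ne i a with rfl | hi <;> simp [*]

theorem commute_onSites (I J : Finset ι) (M : Matrix X X ℂ) :
    Commute (onSites I M) (onSites J M) := by
  rw [Commute, SemiconjBy, onSites, onSites, piTensor_mul, piTensor_mul]
  congr 1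
  ext1 i
  split_ifs <;> simp only [one_mul, mul_one]

theorem isStarProjection_onSites {M : Matrix X X ℂ} (hM : IsStarProjection M) (J : Finset ι) :
    IsStarProjection (onSites J M) :=
  isStarProjection_piTensor fun i => by
    split_ifs
    exacts [hM, .one _]

theorem one_sub_onSites_le {M : Matrix X X ℂ} (hM : IsStarProjection M) (J : Finset ι) :
    1 - onSites J M ≤ ∑ i ∈ J, (1 - onSites {i} M) := by
  induction J using Finset.induction_on with
  | empty => rw [onSites_empty, sub_self, Finset.sum_empty]
  | insert a J ha ih =>
    calc 1 - onSites (insert a J) M = 1 - onSites J M * onSites {a} M := by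
          rw [onSites_insert ha]
      _ ≤ (1 - onSites J M) + (1 - onSites {a} M) :=
          one_sub_mul_le (isStarProjection_onSites hM J) (isStarProjection_onSites hM {a})
            (commute_onSites J {a} M)
      _ ≤ ∑ i ∈ insert a J, (1 - onSites {i} M) := by
          rw [Finset.sum_insert ha, add_comm]
          gcongr

theorem onSites_singleton_mulVec (i : ι) (M : Matrix X X ℂ) (ψ : (ι → X) → ℂ) (x : ι → X) :
    (onSites {i} M *ᵥ ψ) x = ∑ a, M (x i) a * ψ (Function.update x i a) := by
  refine (Fintype.sum_of_injective (Function.update x i) (Function.update_injective x i) _ _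
    (fun y hy => ?_) fun a => ?_).symm
  · obtain ⟨j, hji, hxy⟩ : ∃ j, j ≠ i ∧ x j ≠ y j := by
      by_contra! h
      exact hy ⟨y i, Function.update_eq_iff.mpr ⟨rfl, h⟩⟩
    have hentry : onSites {i} M x y = 0 :=
      Finset.prod_eq_zero (Finset.mem_univ j) (by simp [hji, hxy])
    exact mul_eq_zero_of_left hentry _
  · have hentry : onSites {i} M x (Function.update x i a) = M (x i) a := by
      rw [onSites, piTensor, of_apply, Fintype.prod_eq_single i fun j hj => by simp [hj, one_apply]]
      simp
    exact congrArg (· * _) hentry.symm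

end SiteOperators

section SiteDefects

variable {X ι : Type*} [Fintype X] [DecidableEq X] [Fintype ι] [DecidableEq ι]
  {θ : EuclideanSpace ℂ X}

/-- For a unit vector `θ`, the projection onto the vectors orthogonal to `θ` at site `i`. -/
def siteDefect (θ : EuclideanSpace ℂ X) (i : ι) : Matrix (ι → X) (ι → X) ℂ :=
  1 - onSites {i} (ketBra θ)

theorem isStarProjection_siteDefect (hθ : ‖θ‖ = 1) (i : ι) : IsStarProjection (siteDefect θ i) :=
  (isStarProjection_onSites (isStarProjection_ketBra hθ) {i}).one_sub

theorem commute_toEuclideanLin_siteDefect (i j : ι) :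
    Commute (toEuclideanLin (siteDefect θ i)) (toEuclideanLin (siteDefect θ j)) := by
  have h : Commute (siteDefect θ i) (siteDefect θ j) :=
    (Commute.one_left _).sub_left
      ((Commute.one_right _).sub_right (commute_onSites {i} {j} (ketBra θ)))
  exact (h.map (toEuclideanCLM (n := ι → X) (𝕜 := ℂ))).map ContinuousLinearMap.toLinearMapRingHom

theorem toEuclideanLin_siteDefect_eq_zero (hθ : ‖θ‖ = 1) {i : ι} {ψ : EuclideanSpace ℂ (ι → X)}
    (g : (ι → X) → ℂ) (hψ : ∀ x a, ψ (Function.update x i a) = θ a * g x) :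
    toEuclideanLin (siteDefect θ i) ψ = 0 := by
  have norm_sq : ∑ a, star (θ a) * θ a = 1 := by
    have h := inner_self_eq_norm_sq_to_K (𝕜 := ℂ) θ
    rw [EuclideanSpace.inner_eq_star_dotProduct, dotProduct_comm, hθ, RCLike.ofReal_one,
      one_pow] at h
    exact h
  ext x
  calc (siteDefect θ i *ᵥ ψ.ofLp) x
      = ψ x - ∑ a, θ (x i) * star (θ a) * (θ a * g x) := by
        rw [siteDefect, sub_mulVec, one_mulVec, Pi.sub_apply, onSites_singleton_mulVec]
        simp only [ketBra, vecMulVec_apply, Pi.star_apply, hψ]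
    _ = ψ x - θ (x i) * g x * ∑ a, star (θ a) * θ a := by
        rw [Finset.mul_sum]
        congr! 2
        ring
    _ = 0 := by rw [norm_sq, mul_one, ← hψ, Function.update_eq_self, sub_self]

theorem IsPermInvariant.trace_onSites_map_mul {n : ℕ} {R : Matrix (Fin n → X) (Fin n → X) ℂ}
    (hR : IsPermInvariant R) (π : Equiv.Perm (Fin n)) (J : Finset (Fin n)) (M : Matrix X X ℂ) :
    (onSites (J.map π.toEmbedding) M * R).trace = (onSites J M * R).trace := by
  let e : (Fin n → X) ≃ (Fin n → X) := π.symm.arrowCongr (Equiv.refl X)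
  have h : onSites (J.map π.toEmbedding) M * R = (onSites J M * R).submatrix e e := by
    rw [← onSites_submatrix_comp, ← submatrix_mul_equiv _ _ _ e]
    exact congrArg _ (hR π).symm
  rw [h]
  exact e.sum_comp fun x => (onSites J M * R) x x

theorem IsPermInvariant.trace_siteDefect_mul_eq {n : ℕ} {R : Matrix (Fin n → X) (Fin n → X) ℂ}
    (hR : IsPermInvariant R) (i j : Fin n) :
    (siteDefect θ i * R).trace = (siteDefect θ j * R).trace := by
  have h := hR.trace_onSites_map_mul (Equiv.swap j i) {j} (ketBra θ)
  rw [Finset.map_singleton, Equiv.coe_toEmbedding, Equiv.swap_apply_left] at h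
  rw [siteDefect, siteDefect, sub_mul, sub_mul, trace_sub, trace_sub, h]

end SiteDefects

section AlmostIIDState

variable {X : Type*} [Fintype X] [DecidableEq X] {θ : EuclideanSpace ℂ X} {n r : ℕ}
  {R : Matrix (Fin n → X) (Fin n → X) ℂ}

theorem span_defectVectors_le_defectSpan (hθ : ‖θ‖ = 1) (r : ℕ) :
    Submodule.span ℂ (defectVectors (Nat.sub_le n r) θ) ≤
      defectSpan (fun i : Fin n => toEuclideanLin (siteDefect θ i)) Finset.univ r := by
  refine Submodule.span_mono ?_
  rintro _ ⟨π, Ω, rfl⟩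
  let firstSite (k : Fin (n - r)) : Fin n := Fin.castLE (Nat.sub_le n r) k
  let lastSite (k : Fin (n - (n - r))) : Fin n :=
    Fin.cast (Nat.add_sub_of_le (Nat.sub_le n r)) (Fin.natAdd (n - r) k)
  refine ⟨Finset.univ.map ((Fin.castLEEmb (Nat.sub_le n r)).trans π.toEmbedding),
    Finset.subset_univ _, ?_, fun j hj => ?_⟩
  · rw [Finset.card_map, Finset.card_univ, Finset.card_univ, Fintype.card_fin, Fintype.card_fin]
    lia
  obtain ⟨i, rfl⟩ : ∃ i, π (firstSite i) = j := by simpa using hj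
  refine toEuclideanLin_siteDefect_eq_zero hθ
    (fun x => (∏ k ∈ Finset.univ.erase i, θ (x (π (firstSite k)))) * Ω fun k => x (π (lastSite k)))
    fun x a => ?_
  have ne_first (k) (hk : k ∈ Finset.univ.erase i) : firstSite k ≠ firstSite i := by
    simpa [firstSite, Fin.ext_iff] using Finset.ne_of_mem_erase hk
  have ne_last (k) : lastSite k ≠ firstSite i := fun hk => by
    have h : n - r + k = i.val := congrArg Fin.val hk
    lia
  change (∏ k, θ (Function.update x (π (firstSite i)) a (π (firstSite k)))) *
    Ω (fun k => Function.update x (π (firstSite i)) a (π (lastSite k))) = _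
  rw [← Finset.mul_prod_erase _ _ (Finset.mem_univ i), Function.update_self, mul_assoc]
  congr 2
  · refine Finset.prod_congr rfl fun k hk => ?_
    rw [Function.update_of_ne (π.injective.ne (ne_first k hk))]
  · refine congrArg Ω.ofLp (funext fun k => ?_)
    rw [Function.update_of_ne (π.injective.ne (ne_last k))]

theorem sum_re_trace_siteDefect_mul_le (hθ : ‖θ‖ = 1) (hR : IsDensity R)
    (hsupp : supp R ≤ Submodule.span ℂ (defectVectors (Nat.sub_le n r) θ)) :
    ∑ i, (siteDefect θ i * R).trace.re ≤ (r : ℝ) := by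
  obtain ⟨m, v, hRv, hv, hmem⟩ := hR.exists_ensemble
  calc ∑ i, (siteDefect θ i * R).trace.re
      = ∑ k, ∑ i : Fin n, ‖toEuclideanLin (siteDefect θ i) (v k)‖ ^ 2 := by
        rw [Finset.sum_comm]
        simp only [hRv, Finset.mul_sum, trace_sum, Complex.re_sum,
          re_trace_mul_ketBra (isStarProjection_siteDefect hθ _)]
    _ ≤ ∑ k, r * ‖v k‖ ^ 2 := Finset.sum_le_sum fun k _ =>
        sum_norm_sq_apply_le_of_mem_defectSpan commute_toEuclideanLin_siteDefect
          (fun i => isSymmetricProjection_toEuclideanLin (isStarProjection_siteDefect hθ i))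
          (span_defectVectors_le_defectSpan hθ r (hsupp (hmem k)))
    _ = r := by rw [← Finset.mul_sum, hv, mul_one]

theorem IsPermInvariant.mul_re_trace_siteDefect_mul_le (hperm : IsPermInvariant R) (hθ : ‖θ‖ = 1)
    (hR : IsDensity R) (hsupp : supp R ≤ Submodule.span ℂ (defectVectors (Nat.sub_le n r) θ))
    (i : Fin n) : n * (siteDefect θ i * R).trace.re ≤ r := by
  simpa [hperm.trace_siteDefect_mul_eq _ i] using sum_re_trace_siteDefect_mul_le hθ hR hsupp

theorem IsPermInvariant.mul_one_sub_re_trace_onSites_mul_le (hperm : IsPermInvariant R)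
    (hθ : ‖θ‖ = 1) (hR : IsDensity R)
    (hsupp : supp R ≤ Submodule.span ℂ (defectVectors (Nat.sub_le n r) θ)) (J : Finset (Fin n)) :
    n * (1 - (onSites J (ketBra θ) * R).trace.re) ≤ r * J.card := by
  have union_bound :=
    calc 1 - (onSites J (ketBra θ) * R).trace.re
        = ((1 - onSites J (ketBra θ)) * R).trace.re := by
          rw [sub_mul, one_mul, trace_sub, hR.2, Complex.sub_re, Complex.one_re]
      _ ≤ ((∑ i ∈ J, siteDefect θ i) * R).trace.re :=
          re_trace_mul_le_re_trace_mul (one_sub_onSites_le (isStarProjection_ketBra hθ) J) hR.1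
      _ = ∑ i ∈ J, (siteDefect θ i * R).trace.re := by
          rw [Finset.sum_mul, trace_sum, Complex.re_sum]
  calc n * (1 - (onSites J (ketBra θ) * R).trace.re)
      ≤ ∑ i ∈ J, n * (siteDefect θ i * R).trace.re := by
        rw [← Finset.mul_sum]
        gcongr
    _ ≤ ∑ _i ∈ J, (r : ℝ) := Finset.sum_le_sum fun i _ =>
        hperm.mul_re_trace_siteDefect_mul_le hθ hR hsupp i
    _ = r * J.card := by rw [Finset.sum_const, nsmul_eq_mul, mul_comm]

omit [Fintype X] in
theorem onSites_map_castLEEmb_join {s : ℕ} (h : s ≤ n) (M : Matrix X X ℂ) (x y : Fin s → X)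
    (z w : Fin (n - s) → X) :
    onSites (Finset.univ.map (Fin.castLEEmb h)) M (join h x z) (join h y w) =
      if z = w then tensorPow M s x y else 0 := by
  have castLE_mem (i : Fin s) : Fin.castLE h i ∈ Finset.univ.map (Fin.castLEEmb h) :=
    Finset.mem_map_of_mem (Fin.castLEEmb h) (Finset.mem_univ i)
  have natAdd_notMem (j : Fin (n - s)) : Fin.cast (Nat.add_sub_of_le h) (Fin.natAdd s j) ∉
      Finset.univ.map (Fin.castLEEmb h) := by
    intro hj
    obtain ⟨i, -, hi⟩ := Finset.mem_map.mp hj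
    have h : i.val = s + j := congrArg Fin.val hi
    lia
  rw [onSites, piTensor, of_apply, prod_eq_prod_castLE_mul_prod_natAdd h]
  simp only [natAdd_notMem, castLE_mem, if_true, if_false, join_castLE, join_natAdd, one_apply,
    Finset.prod_ite_zero, Finset.prod_const_one, Finset.mem_univ, true_imp_iff, mul_ite, mul_one,
    mul_zero, funext_iff]
  rfl

theorem trace_onSites_map_castLEEmb_mul {s : ℕ} (h : s ≤ n) (M : Matrix X X ℂ)
    (R : Matrix (Fin n → X) (Fin n → X) ℂ) :
    (onSites (Finset.univ.map (Fin.castLEEmb h)) M * R).trace =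
      (tensorPow M s * trLast h R).trace := by
  simp only [trace, diag, mul_apply, sum_eq_sum_join h, onSites_map_castLEEmb_join, ite_mul,
    zero_mul, Finset.sum_ite_eq, Finset.mem_univ, if_true, trLast, of_apply, Finset.mul_sum]
  exact Finset.sum_congr rfl fun x _ => Finset.sum_comm

theorem IsPermInvariant.mul_one_sub_re_trace_ketBra_vecPow_mul_le (hperm : IsPermInvariant R)
    (hθ : ‖θ‖ = 1) (hR : IsDensity R)
    (hsupp : supp R ≤ Submodule.span ℂ (defectVectors (Nat.sub_le n r) θ)) {s : ℕ} (hs : s ≤ n) :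
    n * (1 - (ketBra (vecPow θ s) * trLast hs R).trace.re) ≤ r * s := by
  rw [← tensorPow_ketBra, ← trace_onSites_map_castLEEmb_mul]
  simpa using
    hperm.mul_one_sub_re_trace_onSites_mul_le hθ hR hsupp (Finset.univ.map (Fin.castLEEmb hs))

end AlmostIIDState

end AlmostIID

open AlmostIID in
theorem mainTheorem4_general {A : Type*} [Fintype A] [DecidableEq A] (n r s : ℕ) (hn : 1 ≤ n)
    (hs : s ≤ n) (σ : Matrix A A ℂ) (hσ : IsDensity σ)
    (ρ : Matrix (Fin n → A) (Fin n → A) ℂ) (hρ : IsAlmostIID r σ ρ) :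
    traceNorm (trLast hs ρ - tensorPow σ s) ≤ 2 * √((r : ℝ) * (s : ℝ) / (n : ℝ)) := by
  obtain ⟨-, d, θ, R, hθσ, hR, rfl, hperm, hsupp⟩ := hρ
  have hθ : ‖θ‖ = 1 := hθσ.norm_eq_one hσ
  have infidelity : 1 - (ketBra (vecPow θ s) * trLast hs R).trace.re ≤ r * s / n := by
    rw [le_div_iff₀' (by positivity)]
    exact hperm.mul_one_sub_re_trace_ketBra_vecPow_mul_le hθ hR hsupp hs
  calc traceNorm (trLast hs (trEs R) - tensorPow σ s)
      = traceNorm (trEs (trLast hs R - ketBra (vecPow θ s))) := by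
        rw [trEs_sub, trLast_trEs, ← tensorPow_ketBra, ← tensorPow_trE, ketBra, hθσ]
    _ ≤ traceNorm (trLast hs R - ketBra (vecPow θ s)) := traceNorm_trEs_le _
    _ ≤ 2 * √(1 - (ketBra (vecPow θ s) * trLast hs R).trace.re) :=
        traceNorm_sub_ketBra_le (hR.trLast hs) (by rw [norm_vecPow, hθ, one_pow])
    _ ≤ 2 * √(r * s / n) := by
        gcongr

theorem mainTheorem4 {A : Type*} [Fintype A] [DecidableEq A] (n r s : ℕ) (hn : 1 ≤ n)
    (hr : r ≤ n) (hs : s ≤ n) (σ : Matrix A A ℂ) (hσ : AlmostIID.IsDensity σ)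
    (ρ : Matrix (Fin n → A) (Fin n → A) ℂ) (hρ : AlmostIID.IsAlmostIID r σ ρ) :
    AlmostIID.traceNorm (AlmostIID.trLast hs ρ - AlmostIID.tensorPow σ s) ≤
      4 * Real.sqrt ((r : ℝ) * (s : ℝ) / (n : ℝ)) := by
  exact (mainTheorem4_general n r s hn hs σ hσ ρ hρ).trans (by gcongr; norm_num)
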